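/- Let $G$ be a finite simple graph with $n \ge 2$ vertices, $e$ edges, vertex degrees $d_1,\dots,d_n$, largest degree $\delta_M$ and smallest degree $\delta_m \neq 0$. Let $A_{ex}(G)$ be the extended adjacency matrix of $G$, i.e. the real symmetric $n\times n$ matrix whose $(i,j)$ entry is $\frac12\left(\frac{d_i}{d_j}+\frac{d_j}{d_i}\right)$ if the vertices $i$ and $j$ are adjacent and $0$ otherwise, and let the extended energy $\varepsilon_{ex}(G)=\sum_{r=1}^{n}|\eta_r|$ be the sum of the absolute values of the eigenvalues $\eta_1,\dots,\eta_n$ (with multiplicity) of $A_{ex}(G)$. Then $$\varepsilon_{ex}(G)\le \frac12\left(\frac{\delta_M}{\delta_m}+\frac{\delta_m}{\delta_M}\right)\sqrt{2ne-\frac n2\left(\sqrt{\delta_M}-\sqrt{\delta_m}\right)^2},$$ and equality holds if and only if $n$ is even and $G$ is isomorphic to $\frac n2 K_2$, the disjoint union of $n/2$ copies of the complete graph $K_2$. -/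

import Mathlib

namespace SimpleGraph

/-- The extended adjacency matrix of a finite simple graph: the `(i, j)` entry is
`(1/2) * (d_i / d_j + d_j / d_i)` if `i` and `j` are adjacent, and `0` otherwise.
(Adjacent vertices have positive degree, so the divisions are genuine.) -/
noncomputable def extAdjMatrix {V : Type*} [Fintype V] (G : SimpleGraph V)
    [DecidableRel G.Adj] : Matrix V V ℝ :=
  Matrix.of fun i j =>
    if G.Adj i j then
      (1 / 2 : ℝ) * ((G.degree i : ℝ) / (G.degree j : ℝ) + (G.degree j : ℝ) / (G.degree i : ℝ))
    else 0

theorem extAdjMatrix_isHermitian {V : Type*} [Fintype V] (G : SimpleGraph V)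
    [DecidableRel G.Adj] : G.extAdjMatrix.IsHermitian := by
  ext i j
  simp only [Matrix.conjTranspose_apply, extAdjMatrix, Matrix.of_apply, star_trivial,
    G.adj_comm j i]
  split_ifs
  · ring
  · rfl

/-- The extended energy of a graph: the sum of the absolute values of the eigenvalues
(with multiplicity) of its extended adjacency matrix. -/
noncomputable def extEnergy {V : Type*} [Fintype V] [DecidableEq V] (G : SimpleGraph V)
    [DecidableRel G.Adj] : ℝ :=
  ∑ r, |G.extAdjMatrix_isHermitian.eigenvalues r|

/-- The disjoint union `k H` of `k` copies of a graph `H`. -/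
def disjointCopies {W : Type*} (k : ℕ) (H : SimpleGraph W) : SimpleGraph (Fin k × W) where
  Adj p q := p.1 = q.1 ∧ H.Adj p.2 q.2
  symm := ⟨fun _ _ h => ⟨h.1.symm, h.2.symm⟩⟩
  loopless := ⟨fun _ h => H.irrefl h.2⟩

end SimpleGraph

/-! Write `A` for the matrix and `F` for the prefactor. Diagonalizing `A` and applying
Cauchy–Schwarz row by row bounds the energy by the sum of the row norms. Every entry is at most `F`,
so row `i` has norm at most `F * √dᵢ`. The sum of the `√dᵢ` is then controlled by their variance,
which is bounded below by the two extreme degrees alone.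

Equality makes both estimates tight. Tight rows force all neighbours of a vertex of maximal degree
to have minimal degree, whereas minimal variance puts every other `√dᵢ` midway between the extremes;
hence `G` is regular. Then all `|ηᵣ|` agree, `A * A` is scalar, and no vertex has two neighbours. -/

open Finset

/-! ### Trace norm and row norms of a real symmetric matrix -/

namespace Matrix.IsHermitian

variable {V : Type*} [Fintype V] [DecidableEq V] {A : Matrix V V ℝ}

theorem eq_mul_diagonal_mul (hA : A.IsHermitian) :
    A = (hA.eigenvectorUnitary : Matrix V V ℝ) * diagonal hA.eigenvalues *
      star (hA.eigenvectorUnitary : Matrix V V ℝ) := by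
  have h := hA.spectral_theorem
  rw [Unitary.conjStarAlgAut_apply] at h
  simpa [Function.comp_def] using h

theorem mul_self_eq (hA : A.IsHermitian) :
    A * A = (hA.eigenvectorUnitary : Matrix V V ℝ) *
      diagonal (fun r => hA.eigenvalues r ^ 2) *
      star (hA.eigenvectorUnitary : Matrix V V ℝ) := by
  have hU : star (hA.eigenvectorUnitary : Matrix V V ℝ) *
      (hA.eigenvectorUnitary : Matrix V V ℝ) = 1 := Unitary.coe_star_mul_self _
  have hD : diagonal (fun r => hA.eigenvalues r ^ 2) =
      diagonal hA.eigenvalues * diagonal hA.eigenvalues := by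
    simp [diagonal_mul_diagonal, sq]
  conv_lhs => rw [hA.eq_mul_diagonal_mul]
  generalize (hA.eigenvectorUnitary : Matrix V V ℝ) = U at *
  rw [hD]
  calc U * diagonal hA.eigenvalues * star U * (U * diagonal hA.eigenvalues * star U)
      = U * diagonal hA.eigenvalues * (star U * U) * diagonal hA.eigenvalues * star U := by
        simp only [Matrix.mul_assoc]
    _ = _ := by rw [hU]; simp only [Matrix.mul_assoc, Matrix.one_mul]

theorem sum_eigenvectorUnitary_sq_row (hA : A.IsHermitian) (i : V) :
    ∑ r, (hA.eigenvectorUnitary : Matrix V V ℝ) i r ^ 2 = 1 := by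
  have h : (hA.eigenvectorUnitary : Matrix V V ℝ) *
      star (hA.eigenvectorUnitary : Matrix V V ℝ) = 1 := Unitary.coe_mul_star_self _
  have := congrFun (congrFun h i) i
  simpa [mul_apply, star_apply, sq] using this

theorem sum_eigenvectorUnitary_sq_col (hA : A.IsHermitian) (r : V) :
    ∑ i, (hA.eigenvectorUnitary : Matrix V V ℝ) i r ^ 2 = 1 := by
  have h : star (hA.eigenvectorUnitary : Matrix V V ℝ) *
      (hA.eigenvectorUnitary : Matrix V V ℝ) = 1 := Unitary.coe_star_mul_self _
  have := congrFun (congrFun h r) r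
  simpa [mul_apply, star_apply, sq] using this

theorem sum_row_sq (hA : A.IsHermitian) (i : V) :
    ∑ j, A i j ^ 2 =
      ∑ r, hA.eigenvalues r ^ 2 * (hA.eigenvectorUnitary : Matrix V V ℝ) i r ^ 2 := by
  have h := congrFun (congrFun hA.mul_self_eq i) i
  rw [mul_apply, mul_apply] at h
  calc ∑ j, A i j ^ 2 = ∑ j, A i j * A j i := by
        refine sum_congr rfl fun j _ => ?_
        have := hA.apply i j
        rw [star_trivial] at this
        rw [this, sq]
    _ = _ := by
        rw [h]
        refine sum_congr rfl fun r _ => ?_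
        rw [mul_diagonal, star_apply, star_trivial]
        ring

theorem sum_eigenvalues_sq (hA : A.IsHermitian) :
    ∑ r, hA.eigenvalues r ^ 2 = ∑ i, ∑ j, A i j ^ 2 := by
  simp_rw [hA.sum_row_sq]
  rw [sum_comm]
  simp_rw [← mul_sum, hA.sum_eigenvectorUnitary_sq_col, mul_one]

/-- The trace norm of a real symmetric matrix is at most the sum of the norms of its rows. -/
theorem sum_abs_eigenvalues_le (hA : A.IsHermitian) :
    ∑ r, |hA.eigenvalues r| ≤ ∑ i, √(∑ j, A i j ^ 2) := by
  set U := (hA.eigenvectorUnitary : Matrix V V ℝ) with hU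
  calc ∑ r, |hA.eigenvalues r| = ∑ r, |hA.eigenvalues r| * ∑ i, U i r ^ 2 := by
        simp_rw [hU, hA.sum_eigenvectorUnitary_sq_col, mul_one]
    _ = ∑ i, ∑ r, |hA.eigenvalues r * U i r| * |U i r| := by
        simp_rw [mul_sum]
        rw [sum_comm]
        refine sum_congr rfl fun i _ => sum_congr rfl fun r _ => ?_
        rw [abs_mul, mul_assoc, abs_mul_abs_self, sq]
    _ ≤ ∑ i, √(∑ j, A i j ^ 2) := by
        -- Cauchy–Schwarz over `r`: the row of `U` is a unit vector, and the other factor is the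
        -- norm of row `i` of `A`.
        refine sum_le_sum fun i _ => ?_
        refine (Real.sum_mul_le_sqrt_mul_sqrt _ _ _).trans_eq ?_
        simp_rw [sq_abs, hU, hA.sum_eigenvectorUnitary_sq_row, Real.sqrt_one, mul_one, mul_pow,
          ← hA.sum_row_sq]

theorem mul_self_eq_smul_one_iff (hA : A.IsHermitian) (c : ℝ) :
    A * A = c • (1 : Matrix V V ℝ) ↔ ∀ r, hA.eigenvalues r ^ 2 = c := by
  have hU : star (hA.eigenvectorUnitary : Matrix V V ℝ) *
      (hA.eigenvectorUnitary : Matrix V V ℝ) = 1 := Unitary.coe_star_mul_self _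
  have hU' : (hA.eigenvectorUnitary : Matrix V V ℝ) *
      star (hA.eigenvectorUnitary : Matrix V V ℝ) = 1 := Unitary.coe_mul_star_self _
  rw [hA.mul_self_eq]
  generalize (hA.eigenvectorUnitary : Matrix V V ℝ) = U at *
  constructor
  · intro h r
    have h1 : diagonal (fun r => hA.eigenvalues r ^ 2) = c • (1 : Matrix V V ℝ) := by
      calc diagonal (fun r => hA.eigenvalues r ^ 2)
          = star U * U * diagonal (fun r => hA.eigenvalues r ^ 2) * (star U * U) := by
            rw [hU, Matrix.one_mul, Matrix.mul_one]
        _ = star U * (U * diagonal (fun r => hA.eigenvalues r ^ 2) * star U) * U := by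
            simp only [Matrix.mul_assoc]
        _ = c • (1 : Matrix V V ℝ) := by
            rw [h, Matrix.mul_smul, Matrix.smul_mul, Matrix.mul_one, hU]
    simpa using congrFun (congrFun h1 r) r
  · intro h
    have h1 : diagonal (fun r => hA.eigenvalues r ^ 2) = c • (1 : Matrix V V ℝ) := by
      simp_rw [h]
      exact (smul_one_eq_diagonal c).symm
    rw [h1, Matrix.mul_smul, Matrix.smul_mul, Matrix.mul_one, hU']

end Matrix.IsHermitian

/-! ### Variance bounded below by two values -/

section Variance

variable {V : Type*} [Fintype V]

theorem card_mul_sum_sq_sub_sq_sum (x : V → ℝ) (μ : ℝ)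
    (hμ : ∑ i, x i = Fintype.card V * μ) :
    Fintype.card V * ∑ i, x i ^ 2 - (∑ i, x i) ^ 2 =
      Fintype.card V * ∑ i, (x i - μ) ^ 2 := by
  simp_rw [sub_sq, sum_add_distrib, sum_sub_distrib, ← sum_mul, ← mul_sum, hμ]
  simp
  ring

variable [DecidableEq V]

/-- In `n * ∑ (xᵢ - μ) ^ 2`, with `μ` the mean, only the terms `a` and `b` are kept, and `p ^ 2 + q
^ 2 ≥ (p - q) ^ 2 / 2`. -/
theorem sq_sum_add_le_card_mul_sum_sq (x : V → ℝ) (a b : V) :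
    (∑ i, x i) ^ 2 + Fintype.card V / 2 * (x a - x b) ^ 2 ≤ Fintype.card V * ∑ i, x i ^ 2 := by
  have hn : (0 : ℝ) < Fintype.card V := by exact_mod_cast Fintype.card_pos_iff.2 ⟨a⟩
  rcases eq_or_ne a b with rfl | hab
  · simpa using sq_sum_le_card_mul_sum_sq (s := univ) (f := x)
  · set μ := (∑ i, x i) / Fintype.card V
    have h := card_mul_sum_sq_sub_sq_sum x μ (by simp only [μ]; field_simp)
    have h2 : (x a - μ) ^ 2 + (x b - μ) ^ 2 ≤ ∑ i, (x i - μ) ^ 2 := by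
      rw [← sum_pair (f := fun i => (x i - μ) ^ 2) hab]
      exact sum_le_sum_of_subset_of_nonneg (subset_univ _) fun i _ _ => sq_nonneg _
    have h3 : (x a - x b) ^ 2 / 2 ≤ ∑ i, (x i - μ) ^ 2 := by
      nlinarith [sq_nonneg (x a + x b - 2 * μ)]
    nlinarith [mul_le_mul_of_nonneg_left h3 hn.le]

/-- Equality kills every discarded term, so `x k = μ`, and makes `μ` the midpoint of `x a` and `x
b`. -/
theorem eq_midpoint_of_sq_sum_add_eq (x : V → ℝ) {a b k : V} (hab : a ≠ b) (hka : k ≠ a)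
    (hkb : k ≠ b)
    (h : (∑ i, x i) ^ 2 + Fintype.card V / 2 * (x a - x b) ^ 2 =
      Fintype.card V * ∑ i, x i ^ 2) :
    x k = (x a + x b) / 2 := by
  have hn : (0 : ℝ) < Fintype.card V := by exact_mod_cast Fintype.card_pos_iff.2 ⟨a⟩
  set μ := (∑ i, x i) / Fintype.card V
  have h1 := card_mul_sum_sq_sub_sq_sum x μ (by simp only [μ]; field_simp)
  have h2 : (x k - μ) ^ 2 + ((x a - μ) ^ 2 + (x b - μ) ^ 2) ≤ ∑ i, (x i - μ) ^ 2 := by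
    rw [← sum_pair (f := fun i => (x i - μ) ^ 2) hab,
      ← sum_insert (f := fun i => (x i - μ) ^ 2) (by simp [hka, hkb])]
    exact sum_le_sum_of_subset_of_nonneg (subset_univ _) fun i _ _ => sq_nonneg _
  have h3 : (x a - x b) ^ 2 / 2 = ∑ i, (x i - μ) ^ 2 := by
    apply mul_left_cancel₀ hn.ne'
    linarith
  have h4 : (x k - μ) ^ 2 + (x a + x b - 2 * μ) ^ 2 / 2 ≤ 0 := by nlinarith
  have h5 : x k - μ = 0 := by
    apply pow_eq_zero_iff two_ne_zero |>.1
    nlinarith [sq_nonneg (x k - μ), sq_nonneg (x a + x b - 2 * μ)]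
  have h6 : x a + x b - 2 * μ = 0 := by
    apply pow_eq_zero_iff two_ne_zero |>.1
    nlinarith [sq_nonneg (x k - μ), sq_nonneg (x a + x b - 2 * μ)]
  linarith

end Variance

theorem div_add_div_swap_le {M m a b : ℝ} (hm : 0 < m) (ha : m ≤ a) (hb : m ≤ b) (ha' : a ≤ M)
    (hb' : b ≤ M) : a / b + b / a ≤ M / m + m / M := by
  have h1 : 0 < a := hm.trans_le ha
  have h2 : 0 < b := hm.trans_le hb
  have h3 : 0 < M := h1.trans_le ha'
  rw [div_add_div _ _ h2.ne' h1.ne', div_add_div _ _ hm.ne' h3.ne',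
    div_le_div_iff₀ (by positivity) (by positivity)]
  -- This product is the difference of the two sides after clearing denominators.
  have h4 : 0 ≤ (M * a - m * b) * (M * b - m * a) := by
    apply mul_nonneg <;> nlinarith
  nlinarith

theorem eq_of_div_add_div_swap_eq {M m b : ℝ} (hm : 0 < m) (hb : m ≤ b)
    (hb' : b ≤ M) (h : M / b + b / M = M / m + m / M) : b = m := by
  have h2 : 0 < b := hm.trans_le hb
  have h3 : 0 < M := h2.trans_le hb'
  rw [div_add_div _ _ h2.ne' h3.ne', div_add_div _ _ hm.ne' h3.ne',
    div_eq_div_iff (by positivity) (by positivity)] at h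
  have h4 : (b - m) * (M ^ 2 - m * b) = 0 := by
    apply mul_left_cancel₀ h3.ne'
    linear_combination -h
  rcases mul_eq_zero.1 h4 with h5 | h5
  · linarith
  -- Here `M ^ 2 = m * b`, so `M * b ≤ M ^ 2 = m * b ≤ m * M`.
  · have : M * (b - m) ≤ 0 := by nlinarith
    nlinarith

/-! ### Perfect matchings, then the extended adjacency matrix -/

namespace SimpleGraph

variable {V : Type*} [Fintype V] (G : SimpleGraph V) [DecidableRel G.Adj]

theorem nonempty_iso_disjointCopies_of_degree_eq_one (h : ∀ v, G.degree v = 1) :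
    Even (Fintype.card V) ∧
      Nonempty (G ≃g disjointCopies (Fintype.card V / 2) (completeGraph (Fin 2))) := by
  have hc : Fintype.card V = 2 * #G.edgeFinset := by
    rw [← G.sum_degrees_eq_twice_card_edges]
    simp [h]
  refine ⟨hc ▸ even_two_mul _, ?_⟩
  have huniq : ∀ {v w w'}, G.Adj v w → G.Adj v w' → w = w' := fun {v _ _} hw hw' =>
    (degree_eq_one_iff_existsUnique_adj.1 (h v)).unique hw hw'
  have hk : Fintype.card (Fin (Fintype.card V / 2)) = Fintype.card G.edgeFinset := by
    rw [Fintype.card_fin, Fintype.card_coe]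
    omega
  let φ := Fintype.equivOfCardEq hk
  -- Copy `k` of `K₂` goes to the `k`-th edge, its ends ordered by `Quot.out`.
  let f : Fin (Fintype.card V / 2) × Fin 2 → V := fun p =>
    if p.2 = 0 then (φ p.1).1.out.1 else (φ p.1).1.out.2
  have hadj : ∀ k, G.Adj (φ k).1.out.1 (φ k).1.out.2 := fun k => by
    rw [← mem_edgeSet, ← mem_edgeFinset]
    have : s((φ k).1.out.1, (φ k).1.out.2) = (φ k).1 := Quot.out_eq _
    rw [this]
    exact (φ k).2
  have hmem : ∀ k i w, G.Adj (f (k, i)) w → s(f (k, i), w) = (φ k).1 := by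
    intro k i w hw
    have hout : s((φ k).1.out.1, (φ k).1.out.2) = (φ k).1 := Quot.out_eq _
    by_cases hi : i = 0
    · simp only [f, hi, if_true] at hw ⊢
      rw [huniq hw (hadj k), hout]
    · simp only [f, hi, if_false] at hw ⊢
      rw [huniq hw (hadj k).symm, Sym2.eq_swap, hout]
  have hij : ∀ k i j, i ≠ j → G.Adj (f (k, i)) (f (k, j)) := by
    intro k i j hne
    fin_cases i <;> fin_cases j <;> simp [f] at hne ⊢
    · exact hadj k
    · exact (hadj k).symm
  have hinj : Function.Injective f := by
    rintro ⟨k, i⟩ ⟨l, j⟩ hkl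
    obtain ⟨w, hw⟩ := (degree_eq_one_iff_existsUnique_adj.1 (h (f (k, i)))).exists
    have h1 := hmem k i w hw
    have h2 := hmem l j w (hkl ▸ hw)
    rw [hkl, h2] at h1
    obtain rfl : l = k := φ.injective (Subtype.ext h1)
    by_contra hne
    have : i ≠ j := fun hh => hne (by rw [hh])
    exact (hij l i j this).ne hkl
  have hbij : Function.Bijective f := by
    refine (Fintype.bijective_iff_injective_and_card f).2 ⟨hinj, ?_⟩
    simp only [Fintype.card_prod, Fintype.card_fin]
    omega
  refine ⟨RelIso.symm ⟨Equiv.ofBijective f hbij, ?_⟩⟩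
  rintro ⟨k, i⟩ ⟨l, j⟩
  simp only [Equiv.ofBijective_apply, disjointCopies, completeGraph, top_adj]
  constructor
  · intro hw
    have h1 := hmem k i _ hw
    have h2 := hmem l j _ hw.symm
    rw [Sym2.eq_swap, h1] at h2
    obtain rfl : k = l := φ.injective (Subtype.ext h2)
    exact ⟨rfl, fun hh => hw.ne (by rw [hh])⟩
  · rintro ⟨rfl, hne⟩
    exact hij k i j hne

theorem degree_eq_one_of_iso_disjointCopies {k : ℕ}
    (φ : G ≃g disjointCopies k (completeGraph (Fin 2))) (v : V) : G.degree v = 1 := by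
  rw [degree_eq_one_iff_existsUnique_adj]
  -- In `Fin 2`, adding 1 swaps the two ends.
  refine ⟨φ.symm ((φ v).1, (φ v).2 + 1), ?_, ?_⟩
  · beta_reduce
    rw [← φ.map_adj_iff, RelIso.apply_symm_apply]
    simp [disjointCopies]
  · intro w hw
    rw [← φ.map_adj_iff] at hw
    simp only [disjointCopies, completeGraph, top_adj] at hw
    rw [RelIso.eq_symm_apply]
    refine Prod.ext hw.1.symm ?_
    have := hw.2
    simp only
    omega

theorem extAdjMatrix_nonneg (i j : V) : 0 ≤ G.extAdjMatrix i j := by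
  simp only [extAdjMatrix, Matrix.of_apply]
  split_ifs <;> positivity

theorem extAdjMatrix_pos {i j : V} (h : G.Adj i j) : 0 < G.extAdjMatrix i j := by
  have hi : 0 < G.degree i := G.degree_pos_iff_exists_adj i |>.2 ⟨j, h⟩
  have hj : 0 < G.degree j := G.degree_pos_iff_exists_adj j |>.2 ⟨i, h.symm⟩
  simp only [extAdjMatrix, Matrix.of_apply, if_pos h]
  positivity

theorem sum_extAdjMatrix_sq (i : V) :
    ∑ j, G.extAdjMatrix i j ^ 2 = ∑ j ∈ G.neighborFinset i, G.extAdjMatrix i j ^ 2 := by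
  symm
  refine sum_subset (subset_univ _) fun j _ hj => ?_
  rw [mem_neighborFinset] at hj
  simp [extAdjMatrix, hj]

theorem extAdjMatrix_le (h0 : 0 < G.minDegree) {i j : V} (h : G.Adj i j) :
    G.extAdjMatrix i j ≤ 1 / 2 * ((G.maxDegree : ℝ) / G.minDegree + G.minDegree / G.maxDegree) := by
  simp only [extAdjMatrix, Matrix.of_apply, if_pos h]
  have := div_add_div_swap_le (M := G.maxDegree) (m := G.minDegree) (a := G.degree i)
    (b := G.degree j) (by exact_mod_cast h0) (by exact_mod_cast G.minDegree_le_degree i)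
    (by exact_mod_cast G.minDegree_le_degree j) (by exact_mod_cast G.degree_le_maxDegree i)
    (by exact_mod_cast G.degree_le_maxDegree j)
  linarith

theorem sqrt_sum_extAdjMatrix_sq_le (h0 : 0 < G.minDegree) (i : V) :
    √(∑ j, G.extAdjMatrix i j ^ 2) ≤
      1 / 2 * ((G.maxDegree : ℝ) / G.minDegree + G.minDegree / G.maxDegree) * √(G.degree i) := by
  set F := 1 / 2 * ((G.maxDegree : ℝ) / G.minDegree + G.minDegree / G.maxDegree)
  have hF : 0 ≤ F := by positivity
  rw [G.sum_extAdjMatrix_sq, Real.sqrt_le_left (by positivity), mul_pow, Real.sq_sqrt (by positivity),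
    ← card_neighborFinset_eq_degree, mul_comm, ← nsmul_eq_mul]
  refine sum_le_card_nsmul _ _ _ fun j hj => ?_
  rw [mem_neighborFinset] at hj
  exact pow_le_pow_left₀ (G.extAdjMatrix_nonneg i j) (G.extAdjMatrix_le h0 hj) 2

theorem extAdjMatrix_eq_of_sqrt_sum_eq (h0 : 0 < G.minDegree) {i j : V} (hij : G.Adj i j)
    (h : √(∑ j, G.extAdjMatrix i j ^ 2) =
      1 / 2 * ((G.maxDegree : ℝ) / G.minDegree + G.minDegree / G.maxDegree) * √(G.degree i)) :
    G.extAdjMatrix i j =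
      1 / 2 * ((G.maxDegree : ℝ) / G.minDegree + G.minDegree / G.maxDegree) := by
  set F := 1 / 2 * ((G.maxDegree : ℝ) / G.minDegree + G.minDegree / G.maxDegree) with hFdef
  have hF : 0 ≤ F := by positivity
  have h1 := congrArg (· ^ 2) h
  simp only [mul_pow] at h1
  rw [Real.sq_sqrt (by positivity), Real.sq_sqrt (by positivity), G.sum_extAdjMatrix_sq,
    ← card_neighborFinset_eq_degree, mul_comm, ← nsmul_eq_mul, ← sum_const] at h1
  have h2 := (sum_eq_sum_iff_of_le fun k hk => pow_le_pow_left₀ (G.extAdjMatrix_nonneg i k)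
    (G.extAdjMatrix_le h0 ((G.mem_neighborFinset i k).1 hk)) 2).1 h1 j
    ((G.mem_neighborFinset i j).2 hij)
  exact (pow_left_inj₀ (G.extAdjMatrix_nonneg i j) hF two_ne_zero).1 h2

variable [DecidableEq V]

/-- Two neighbours `j ≠ k` of `v` would make the off-diagonal `(j, k)` entry of the square positive,
since entries are nonnegative and the path through `v` contributes. -/
theorem degree_le_one_of_extAdjMatrix_mul_self {c : ℝ}
    (h : G.extAdjMatrix * G.extAdjMatrix = c • (1 : Matrix V V ℝ)) (v : V) : G.degree v ≤ 1 := by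
  by_contra! hv
  rw [← card_neighborFinset_eq_degree] at hv
  obtain ⟨j, hj, k, hk, hjk⟩ := one_lt_card.1 hv
  rw [mem_neighborFinset] at hj hk
  have h1 := congrFun (congrFun h j) k
  rw [Matrix.mul_apply, Matrix.smul_apply, Matrix.one_apply_ne hjk, smul_zero] at h1
  have h2 := (sum_eq_zero_iff_of_nonneg fun l _ =>
    mul_nonneg (G.extAdjMatrix_nonneg j l) (G.extAdjMatrix_nonneg l k)).1 h1 v (mem_univ v)
  exact (mul_pos (G.extAdjMatrix_pos hj.symm) (G.extAdjMatrix_pos hk)).ne' h2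

theorem extAdjMatrix_mul_self_of_degree_eq_one (h : ∀ v, G.degree v = 1) :
    G.extAdjMatrix * G.extAdjMatrix = (1 : ℝ) • (1 : Matrix V V ℝ) := by
  have hA : ∀ i j, G.extAdjMatrix i j = if G.Adj i j then 1 else 0 := fun i j => by
    simp only [extAdjMatrix, Matrix.of_apply, h]
    norm_num
  ext i k
  obtain ⟨j, hj, hju⟩ := degree_eq_one_iff_existsUnique_adj.1 (h i)
  obtain ⟨l, hl, hlu⟩ := degree_eq_one_iff_existsUnique_adj.1 (h j)
  rw [one_smul, Matrix.mul_apply, sum_eq_single j, hA, hA, if_pos hj, Matrix.one_apply, one_mul]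
  · have : G.Adj j k ↔ i = k :=
      ⟨fun hh => (hlu i hj.symm).trans (hlu k hh).symm, fun hh => hh ▸ hj.symm⟩
    simp only [this]
  · intro m _ hm
    rw [hA, if_neg fun hh => hm (hju m hh), zero_mul]
  · simp

theorem extEnergy_of_degree_eq_one (h : ∀ v, G.degree v = 1) :
    G.extEnergy = Fintype.card V := by
  have h1 := (G.extAdjMatrix_isHermitian.mul_self_eq_smul_one_iff 1).1
    (G.extAdjMatrix_mul_self_of_degree_eq_one h)
  have h2 : ∀ r, |G.extAdjMatrix_isHermitian.eigenvalues r| = 1 := fun r => by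
    rw [← Real.sqrt_sq_eq_abs, h1, Real.sqrt_one]
  simp [extEnergy, h2]

theorem sq_sum_sqrt_degree_add_le [Nonempty V] :
    (∑ i, √(G.degree i : ℝ)) ^ 2 +
        Fintype.card V / 2 * (√(G.maxDegree : ℝ) - √(G.minDegree : ℝ)) ^ 2 ≤
      Fintype.card V * ∑ i, (G.degree i : ℝ) := by
  obtain ⟨v, hv⟩ := G.exists_maximal_degree_vertex
  obtain ⟨u, hu⟩ := G.exists_minimal_degree_vertex
  have := sq_sum_add_le_card_mul_sum_sq (fun i => √(G.degree i : ℝ)) v u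
  simp only [Real.sq_sqrt (Nat.cast_nonneg _)] at this
  rwa [hv, hu]

/-- The rows of the extended adjacency matrix have maximal norm and the square roots of the degrees
have minimal variance only if the graph is regular. -/
theorem minDegree_eq_maxDegree_of_extremal [Nonempty V] (h0 : 0 < G.minDegree)
    (hrow : ∀ i, √(∑ j, G.extAdjMatrix i j ^ 2) =
      1 / 2 * ((G.maxDegree : ℝ) / G.minDegree + G.minDegree / G.maxDegree) * √(G.degree i))
    (hvar : (∑ i, √(G.degree i : ℝ)) ^ 2 +
        Fintype.card V / 2 * (√(G.maxDegree : ℝ) - √(G.minDegree : ℝ)) ^ 2 =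
      Fintype.card V * ∑ i, (G.degree i : ℝ)) :
    G.minDegree = G.maxDegree := by
  obtain ⟨v, hv⟩ := G.exists_maximal_degree_vertex
  obtain ⟨u, hu⟩ := G.exists_minimal_degree_vertex
  by_contra hne
  have hle : G.minDegree ≤ G.maxDegree := G.minDegree_le_maxDegree
  have hvu : v ≠ u := fun h => hne (by rw [hu, hv, h])
  have hnb : ∀ k, G.Adj v k → G.degree k = G.minDegree := by
    intro k hk
    have h1 := G.extAdjMatrix_eq_of_sqrt_sum_eq h0 hk (hrow v)
    simp only [extAdjMatrix, Matrix.of_apply, if_pos hk, ← hv] at h1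
    exact_mod_cast eq_of_div_add_div_swap_eq (by exact_mod_cast h0)
      (by exact_mod_cast G.minDegree_le_degree k) (by exact_mod_cast G.degree_le_maxDegree k)
      (mul_left_cancel₀ (by norm_num) h1)
  -- The maximal degree exceeds a positive minimal degree, so `v` has a neighbour other than `u`.
  have hcard : 1 < #(G.neighborFinset v) := by
    rw [card_neighborFinset_eq_degree]
    omega
  obtain ⟨k, hk, hku⟩ := exists_mem_ne hcard u
  rw [mem_neighborFinset] at hk
  have h1 := eq_midpoint_of_sq_sum_add_eq (fun i => √(G.degree i : ℝ)) hvu hk.ne' hku (by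
    simp only [Real.sq_sqrt (Nat.cast_nonneg _)]
    rwa [← hv, ← hu])
  simp only [hnb k hk, ← hv, ← hu] at h1
  have h2 : √(G.minDegree : ℝ) = √(G.maxDegree : ℝ) := by linarith
  rw [Real.sqrt_inj (by positivity) (by positivity)] at h2
  exact hne (by exact_mod_cast h2)

/-- In the regular case the squared eigenvalues sum to `n * d`, so this energy is the equality case
of Cauchy–Schwarz: every `|ηᵣ|` is `√d`. -/
theorem degree_eq_one_of_extEnergy_eq {d : ℕ} (hd : 0 < d) (hreg : ∀ v, G.degree v = d)
    (hE : G.extEnergy = Fintype.card V * √d) (v : V) : G.degree v = 1 := by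
  have hA : ∀ i j, G.extAdjMatrix i j = if G.Adj i j then 1 else 0 := fun i j => by
    have : (d : ℝ) ≠ 0 := by exact_mod_cast hd.ne'
    simp only [extAdjMatrix, Matrix.of_apply, hreg, div_self this]
    norm_num
  have hrow : ∀ i, ∑ j, G.extAdjMatrix i j ^ 2 = d := fun i => by
    rw [G.sum_extAdjMatrix_sq, ← hreg i, ← card_neighborFinset_eq_degree, card_eq_sum_ones,
      Nat.cast_sum]
    refine sum_congr rfl fun j hj => ?_
    simp [hA, (G.mem_neighborFinset i j).1 hj]
  have hsq := G.extAdjMatrix_isHermitian.sum_eigenvalues_sq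
  simp only [hrow, sum_const, card_univ, nsmul_eq_mul] at hsq
  rw [extEnergy] at hE
  have hzero : ∑ r, (|G.extAdjMatrix_isHermitian.eigenvalues r| - √d) ^ 2 = 0 := by
    simp_rw [sub_sq, sum_add_distrib, sum_sub_distrib, ← sum_mul, ← mul_sum, hE, sq_abs, hsq]
    simp only [sum_const, card_univ, nsmul_eq_mul]
    have := Real.mul_self_sqrt (Nat.cast_nonneg (α := ℝ) d)
    linear_combination (-(Fintype.card V : ℝ)) * this
  have heig : ∀ r, G.extAdjMatrix_isHermitian.eigenvalues r ^ 2 = d := fun r => by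
    have h1 := (sum_eq_zero_iff_of_nonneg fun _ _ => sq_nonneg _).1 hzero r (mem_univ r)
    have h2 : |G.extAdjMatrix_isHermitian.eigenvalues r| = √d := by
      have := pow_eq_zero_iff two_ne_zero |>.1 h1
      linarith
    rw [← sq_abs, h2, Real.sq_sqrt (Nat.cast_nonneg _)]
  have := G.degree_le_one_of_extAdjMatrix_mul_self
    ((G.extAdjMatrix_isHermitian.mul_self_eq_smul_one_iff _).2 heig) v
  have := hreg v
  omega

end SimpleGraph

/-! ### The bound and its equality case -/

theorem mainTheorem9 {V : Type*} [Fintype V] [DecidableEq V] (G : SimpleGraph V)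
    [DecidableRel G.Adj] (n e : ℕ) (hn : Fintype.card V = n) (he : G.edgeFinset.card = e)
    (hn2 : 2 ≤ n) (δM δm : ℝ) (hδM : δM = (G.maxDegree : ℝ)) (hδm : δm = (G.minDegree : ℝ))
    (hδm0 : δm ≠ 0) :
    G.extEnergy ≤
        (1 / 2 : ℝ) * (δM / δm + δm / δM) *
          √(2 * (n : ℝ) * (e : ℝ) - (n : ℝ) / 2 * (√δM - √δm) ^ 2) ∧
      (G.extEnergy =
          (1 / 2 : ℝ) * (δM / δm + δm / δM) *
            √(2 * (n : ℝ) * (e : ℝ) - (n : ℝ) / 2 * (√δM - √δm) ^ 2) ↔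
        Even n ∧
          Nonempty (G ≃g SimpleGraph.disjointCopies (n / 2) (SimpleGraph.completeGraph (Fin 2)))) := by
  subst hδM hδm hn he
  have : Nonempty V := Fintype.card_pos_iff.1 (by omega)
  have h0 : 0 < G.minDegree := Nat.pos_of_ne_zero (by exact_mod_cast hδm0)
  have h0M : 0 < G.maxDegree := h0.trans_le G.minDegree_le_maxDegree
  have hdeg : ∑ i, (G.degree i : ℝ) = 2 * (#G.edgeFinset : ℝ) := by
    exact_mod_cast G.sum_degrees_eq_twice_card_edges
  have hvar := G.sq_sum_sqrt_degree_add_le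
  have hrows := fun i => G.sqrt_sum_extAdjMatrix_sq_le h0 i
  have hsum : G.extEnergy ≤ ∑ i, √(∑ j, G.extAdjMatrix i j ^ 2) :=
    G.extAdjMatrix_isHermitian.sum_abs_eigenvalues_le
  set F := 1 / 2 * ((G.maxDegree : ℝ) / G.minDegree + G.minDegree / G.maxDegree) with hFdef
  have hF : 0 < F := by positivity
  set S := ∑ i, √(G.degree i : ℝ) with hS
  have hS0 : 0 ≤ S := sum_nonneg fun _ _ => Real.sqrt_nonneg _
  set X := 2 * (Fintype.card V : ℝ) * (#G.edgeFinset : ℝ) -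
    (Fintype.card V : ℝ) / 2 * (√(G.maxDegree : ℝ) - √(G.minDegree : ℝ)) ^ 2 with hX
  have hSX : S ^ 2 ≤ X := by rw [hdeg] at hvar; linarith
  have hSX' : S ≤ √X := Real.le_sqrt_of_sq_le hSX
  have hFS : ∑ i, √(∑ j, G.extAdjMatrix i j ^ 2) ≤ F * S := by
    rw [hS, mul_sum]
    exact sum_le_sum fun i _ => hrows i
  have hFX : F * S ≤ F * √X := mul_le_mul_of_nonneg_left hSX' hF.le
  refine ⟨hsum.trans (hFS.trans hFX), ⟨fun hE => ?_, ?_⟩⟩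
  -- Equality at the ends collapses the chain energy ≤ row norms ≤ `F * S` ≤ `F * √X`.
  · have hS_eq : S = √X := mul_left_cancel₀ hF.ne' (by linarith)
    have hrow_eq : ∀ i, √(∑ j, G.extAdjMatrix i j ^ 2) = F * √(G.degree i) := fun i =>
      (sum_eq_sum_iff_of_le fun i _ => hrows i).1
        (by rw [← mul_sum, ← hS]; linarith) i (mem_univ i)
    have hreg : G.minDegree = G.maxDegree := by
      refine G.minDegree_eq_maxDegree_of_extremal h0 hrow_eq ?_
      rw [← hS, hS_eq, Real.sq_sqrt ((sq_nonneg S).trans hSX), hdeg, hX]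
      ring
    have hd : ∀ v, G.degree v = G.maxDegree := fun v =>
      le_antisymm (G.degree_le_maxDegree v) (hreg ▸ G.minDegree_le_degree v)
    have hF1 : F = 1 := by
      have : (G.maxDegree : ℝ) ≠ 0 := by exact_mod_cast h0M.ne'
      rw [hFdef, hreg, div_self this]
      norm_num
    refine G.nonempty_iso_disjointCopies_of_degree_eq_one
      (G.degree_eq_one_of_extEnergy_eq h0M hd ?_)
    rw [hE, ← hS_eq, hF1, one_mul, hS]
    simp [hd]
  · rintro ⟨-, ⟨φ⟩⟩
    have hd := G.degree_eq_one_of_iso_disjointCopies φ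
    have hM : G.maxDegree = 1 := by
      obtain ⟨v, hv⟩ := G.exists_maximal_degree_vertex
      rw [hv, hd]
    have hm : G.minDegree = 1 := by
      obtain ⟨v, hv⟩ := G.exists_minimal_degree_vertex
      rw [hv, hd]
    have hX1 : X = (Fintype.card V : ℝ) ^ 2 := by
      simp only [hd, Nat.cast_one, sum_const, card_univ, nsmul_eq_mul, mul_one] at hdeg
      rw [hX, hM, hm, sub_self]
      linear_combination (-(Fintype.card V : ℝ)) * hdeg
    have hF1 : F = 1 := by
      rw [hFdef, hM, hm]
      norm_num
    rw [G.extEnergy_of_degree_eq_one hd, hF1, hX1, Real.sqrt_sq (by positivity), one_mul]
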